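/- Let $\lambda>0$, $\alpha>2$ and $0<\phi\le 2\pi$. Let $\Phi=\{x_i\}$ be a homogeneous Poisson point process on $\mathbb{R}^2$ with intensity $\lambda$, and let the channel gains $h_i$ be i.i.d. copies of a random variable $h$, independent of $\Phi$, with $h>0$ almost surely and $E[h^{2/\alpha}]<\infty$. A receiver at a fixed $x\in\mathbb{R}^2$ receives from the nodes $x_i\in\Phi$ for which the angle in $[0,2\pi)$ of the vector $x_i-x$ with respect to the horizontal axis is at most $\phi$; node $i$ causes the interference power $h_i\|x-x_i\|^{-\alpha}$. For $n=1,2,\dots$ let $I_n$, the $n$-th dominant interference power, be the $n$-th largest of the interference powers of the nodes from which the receiver receives. Then for every integer $n>\alpha/2$ the random variable $I_n$ is integrable and $$E[I_n]=\left(\frac{\phi\,E[h^{2/\alpha}]\,\lambda}{2}\right)^{\alpha/2}\frac{\Gamma(n-\alpha/2)}{\Gamma(n)}.$$ -/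

import Mathlib

open MeasureTheory ProbabilityTheory

/-- The Euclidean plane, with its Lebesgue measure `volume`. -/
abbrev Plane : Type := EuclideanSpace ℝ (Fin 2)

/-- The number of points of the configuration `X 0 ω, X 1 ω, …` that lie in `B`. -/
noncomputable def pointCount {Ω E : Type*} (X : ℕ → Ω → E) (B : Set E) (ω : Ω) : ℕ∞ :=
  {i : ℕ | X i ω ∈ B}.encard

/-- The random points `X 0, X 1, …` form a Poisson point process with intensity measure `Λ`:
the number of points in a Borel set `B` of finite intensity is Poisson distributed with mean `Λ B`,
and the numbers of points in finitely many pairwise disjoint Borel sets are independent. -/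
structure IsPoissonPointProcess {Ω E : Type*} [MeasurableSpace Ω] [MeasurableSpace E]
    (X : ℕ → Ω → E) (Λ : Measure E) (P : Measure Ω) : Prop where
  measurable_point : ∀ i, Measurable (X i)
  count_law : ∀ B : Set E, MeasurableSet B → Λ B ≠ ⊤ →
    HasLaw (pointCount X B)
      ((poissonMeasure (Λ B).toNNReal).map (fun k : ℕ => (k : ℕ∞))) P
  count_indep : ∀ (m : ℕ) (B : Fin m → Set E), (∀ j, MeasurableSet (B j)) →
    Pairwise (fun j k => Disjoint (B j) (B k)) →
    iIndepFun (fun j => pointCount X (B j)) P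

/-- The random variables `h 0, h 1, …` are i.i.d. with law `ν`, and independent of the
family of points `X 0, X 1, …`. -/
structure IsIndependentMarking {Ω E : Type*} [MeasurableSpace Ω] [MeasurableSpace E]
    (X : ℕ → Ω → E) (h : ℕ → Ω → ℝ) (ν : Measure ℝ) (P : Measure Ω) : Prop where
  measurable_mark : ∀ i, Measurable (h i)
  mark_law : ∀ i, HasLaw (h i) ν P
  mark_iIndep : iIndepFun h P
  indep_points : IndepFun (fun ω i => X i ω) (fun ω i => h i ω) P

/-- The angle in `[0, 2π)` of a plane vector with respect to the horizontal axis. -/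
noncomputable def polarAngle (v : Plane) : ℝ :=
  if 0 ≤ Complex.arg ⟨v 0, v 1⟩ then Complex.arg ⟨v 0, v 1⟩
  else Complex.arg ⟨v 0, v 1⟩ + 2 * Real.pi

/-- The points from which a receiver at `x` with reception angle `φ` receives. -/
def receptionSector (x : Plane) (φ : ℝ) : Set Plane :=
  {y | polarAngle (y - x) ≤ φ}

/-- The interference power at `x` of node `i`, at position `X i` and with channel gain `h i`. -/
noncomputable def interferencePower {Ω : Type*} (X : ℕ → Ω → Plane) (h : ℕ → Ω → ℝ)
    (α : ℝ) (x : Plane) (i : ℕ) (ω : Ω) : ℝ :=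
  h i ω * ‖x - X i ω‖ ^ (-α)

/-- The `n`-th largest (`n = 1, 2, …`) of the numbers `v i`, `i ∈ S`, counted with multiplicity:
the largest threshold `t` that is reached by at least `n` of them. -/
noncomputable def nthLargest (S : Set ℕ) (v : ℕ → ℝ) (n : ℕ) : ℝ :=
  sSup {t : ℝ | (n : ℕ∞) ≤ {i | i ∈ S ∧ t ≤ v i}.encard}

/-- If the family has a strictly decreasing enumeration `v (e 0) > v (e 1) > …`, then its
`n`-th largest member is the `n`-th term of this enumeration. -/
theorem nthLargest_eq_of_strictAnti {S : Set ℕ} {v : ℕ → ℝ} (e : ℕ → ℕ)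
    (he : Set.BijOn e Set.univ S) (hv : StrictAnti (fun k => v (e k))) (n : ℕ) :
    nthLargest S v (n + 1) = v (e n) := by
  apply IsGreatest.csSup_eq
  constructor
  · have h1 : e '' (Set.Iic n) ⊆ {i | i ∈ S ∧ v (e n) ≤ v i} := by
      rintro _ ⟨k, hk, rfl⟩
      exact ⟨he.mapsTo (Set.mem_univ k), hv.antitone hk⟩
    have h2 := Set.encard_le_encard h1
    rw [(he.injOn.mono (Set.subset_univ _)).encard_image] at h2
    have h3 : (Set.Iic n).encard = ((n + 1 : ℕ) : ℕ∞) := by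
      rw [← Finset.coe_Iic, Set.encard_coe_eq_coe_finsetCard, Nat.card_Iic]
    rw [h3] at h2
    exact h2
  · intro t ht
    by_contra! hlt
    have h1 : {i | i ∈ S ∧ t ≤ v i} ⊆ e '' (Set.Iio n) := by
      rintro i ⟨hi, hti⟩
      obtain ⟨k, -, rfl⟩ := he.surjOn hi
      exact ⟨k, hv.lt_iff_gt.mp (lt_of_lt_of_le hlt hti), rfl⟩
    have h2 := (Set.encard_le_encard h1).trans (Set.encard_image_le _ _)
    have h3 : (Set.Iio n).encard = (n : ℕ∞) := by
      rw [← Finset.coe_Iio, Set.encard_coe_eq_coe_finsetCard, Nat.card_Iio]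
    rw [h3] at h2
    have h4 : ((n + 1 : ℕ) : ℕ∞) ≤ (n : ℕ∞) := le_trans ht h2
    exact absurd (Nat.cast_le.mp h4) (by omega)

/-- The `n`-th dominant interference power at a receiver at `x` with reception angle `φ`:
the `n`-th largest of the interference powers of the nodes in the reception sector. -/
noncomputable def dominantInterference {Ω : Type*} (X : ℕ → Ω → Plane) (h : ℕ → Ω → ℝ)
    (α : ℝ) (x : Plane) (φ : ℝ) (n : ℕ) (ω : Ω) : ℝ :=
  nthLargest {i | X i ω ∈ receptionSector x φ} (fun i => interferencePower X h α x i ω) n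

/-!
A node together with its channel gain causes an interference power of at least `t` when this pair
lies in a certain set of marked points. The marked process is Poisson, with intensity the product
of `lam • volume` and the law `ν` of the gains: averaging over the gains replaces a test function
`u` by `y ↦ ∫ k, u (y, k) ∂ν` in the generating functional, which determines the law of every count.
For a fixed gain the section of the set is a circular sector, so its measure under this intensity is
`c * t ^ (-(2 / α))` with `c = φ * E[h ^ (2 / α)] * lam / 2`. Hence `t ≤ I_n` says that a Poisson
variable of this mean is at least `n`. By the duality between Poisson counts and Gamma waiting times
this has the probability of `G ≤ c * t ^ (-(2 / α))`, where `G` has the Gamma distribution of shape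
`n` and rate `1`. So `I_n` is distributed as `(c / G) ^ (α / 2)`, and its mean is `c ^ (α / 2)`
times a negative moment of `G`.
-/

open Filter Topology
open scoped ENNReal NNReal

section Product

variable {ι R : Type*} [NormedCommRing R] [NormOneClass R] {s : Finset ι} {a b : ι → R}

theorem norm_prod_le_one (ha : ∀ i ∈ s, ‖a i‖ ≤ 1) : ‖∏ i ∈ s, a i‖ ≤ 1 :=
  (s.norm_prod_le a).trans (Finset.prod_le_one (fun _ _ => norm_nonneg _) ha)

theorem norm_prod_sub_prod_le_sum (ha : ∀ i ∈ s, ‖a i‖ ≤ 1) (hb : ∀ i ∈ s, ‖b i‖ ≤ 1) :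
    ‖∏ i ∈ s, a i - ∏ i ∈ s, b i‖ ≤ ∑ i ∈ s, ‖a i - b i‖ := by
  classical
  induction s using Finset.induction_on with
  | empty => simp
  | insert j s hj ih =>
    rw [Finset.forall_mem_insert] at ha hb
    rw [Finset.prod_insert hj, Finset.prod_insert hj, Finset.sum_insert hj]
    calc ‖a j * ∏ i ∈ s, a i - b j * ∏ i ∈ s, b i‖
        = ‖(a j - b j) * ∏ i ∈ s, a i + b j * (∏ i ∈ s, a i - ∏ i ∈ s, b i)‖ := by
          congr 1
          ring
      _ ≤ ‖a j - b j‖ * ‖∏ i ∈ s, a i‖ + ‖b j‖ * ‖∏ i ∈ s, a i - ∏ i ∈ s, b i‖ :=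
          (norm_add_le _ _).trans (add_le_add (norm_mul_le _ _) (norm_mul_le _ _))
      _ ≤ ‖a j - b j‖ + ∑ i ∈ s, ‖a i - b i‖ :=
          add_le_add (mul_le_of_le_one_right (norm_nonneg _) (norm_prod_le_one ha.2))
            ((mul_le_of_le_one_left (norm_nonneg _) hb.1).trans (ih ha.2 hb.2))

end Product

theorem tendsto_prod_mulIndicator_pow_pointCount {Ω E : Type*} {X : ℕ → Ω → E} {B : Set E}
    {ω : Ω} (hω : pointCount X B ω ≠ ⊤) (z : ℂ) :
    Tendsto (fun M => ∏ i ∈ Finset.range M, B.mulIndicator (fun _ => z) (X i ω)) atTop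
      (𝓝 (z ^ (pointCount X B ω).toNat)) := by
  have hfin : {i | X i ω ∈ B}.Finite := Set.encard_ne_top_iff.1 hω
  have hprod : HasProd (fun i => B.mulIndicator (fun _ => z) (X i ω))
      (∏ i ∈ hfin.toFinset, B.mulIndicator (fun _ => z) (X i ω)) :=
    hasProd_prod_of_ne_finset_one fun i hi =>
      Set.mulIndicator_of_notMem (by simpa using hi) _
  convert hprod.tendsto_prod_nat using 2
  rw [Finset.prod_congr rfl fun i hi =>
    Set.mulIndicator_of_mem (by simpa using hi) (fun _ => z), Finset.prod_const, pointCount,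
    hfin.encard_eq_coe_toFinset_card, ENat.toNat_natCast]

section PointProcess

variable {Ω E : Type*} [MeasurableSpace Ω] [MeasurableSpace E] {X : ℕ → Ω → E} {P : Measure Ω}
  {B : Set E}

/-- The intensity measure of the point process `X 0, X 1, …`, which assigns to a set the mean number
of points in it. -/
noncomputable def intensityMeasure (X : ℕ → Ω → E) (P : Measure Ω) : Measure E :=
  Measure.sum fun i => P.map (X i)

theorem measurable_pointCount (hX : ∀ i, Measurable (X i)) (hB : MeasurableSet B) :
    Measurable (pointCount X B) :=
  measurable_encard.comp (measurable_set_iff.2 fun i => measurable_mem.2 (hX i hB))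

theorem lintegral_pointCount (hX : ∀ i, Measurable (X i)) (hB : MeasurableSet B) :
    ∫⁻ ω, (pointCount X B ω : ℝ≥0∞) ∂P = intensityMeasure X P B := by
  have hcount : ∀ ω, (pointCount X B ω : ℝ≥0∞) = ∑' i, (X i ⁻¹' B).indicator 1 ω := fun ω => by
    rw [pointCount, ← ENNReal.tsum_set_one, tsum_subtype _ (fun _ => (1 : ℝ≥0∞))]
    rfl
  simp_rw [hcount]
  rw [lintegral_tsum fun i => (measurable_one.indicator (hX i hB)).aemeasurable, intensityMeasure,
    Measure.sum_apply _ hB]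
  exact tsum_congr fun i => by
    rw [lintegral_indicator_one (hX i hB), Measure.map_apply (hX i) hB]

theorem ae_pointCount_ne_top (hX : ∀ i, Measurable (X i)) (hB : MeasurableSet B)
    (hfin : intensityMeasure X P B ≠ ⊤) : ∀ᵐ ω ∂P, pointCount X B ω ≠ ⊤ := by
  rw [← lintegral_pointCount hX hB] at hfin
  have hmeas : Measurable fun ω => (pointCount X B ω : ℝ≥0∞) :=
    Measurable.of_discrete.comp (measurable_pointCount hX hB)
  filter_upwards [ae_lt_top hmeas hfin] with ω hω htop
  simp [htop] at hω

section Bounded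

variable [IsFiniteMeasure P] {u v : E → ℂ}

theorem integrable_prod_of_norm_le_one (hX : ∀ i, Measurable (X i)) (hu : Measurable u)
    (hu_le : ∀ y, ‖u y‖ ≤ 1) (s : Finset ℕ) : Integrable (fun ω => ∏ i ∈ s, u (X i ω)) P :=
  Integrable.of_bound (C := 1)
    (Finset.measurable_fun_prod _ fun i _ => hu.comp (hX i)).aestronglyMeasurable
    (ae_of_all _ fun _ => norm_prod_le_one fun _ _ => hu_le _)

theorem tendsto_integral_prod_of_ae_tendsto (hX : ∀ i, Measurable (X i)) (hu : Measurable u)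
    (hu_le : ∀ y, ‖u y‖ ≤ 1) {Y : Ω → ℂ}
    (hY : ∀ᵐ ω ∂P, Tendsto (fun M => ∏ i ∈ Finset.range M, u (X i ω)) atTop (𝓝 (Y ω))) :
    Tendsto (fun M => ∫ ω, ∏ i ∈ Finset.range M, u (X i ω) ∂P) atTop (𝓝 (∫ ω, Y ω ∂P)) :=
  tendsto_integral_of_dominated_convergence (fun _ => 1)
    (fun M => (integrable_prod_of_norm_le_one hX hu hu_le (Finset.range M)).aestronglyMeasurable)
    (integrable_const _)
    (fun _ => ae_of_all _ fun _ => norm_prod_le_one fun _ _ => hu_le _) hY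

theorem norm_integral_prod_sub_integral_prod_le (hX : ∀ i, Measurable (X i)) (hu : Measurable u)
    (hu_le : ∀ y, ‖u y‖ ≤ 1) (hv : Measurable v) (hv_le : ∀ y, ‖v y‖ ≤ 1)
    (huv : Integrable (fun y => u y - v y) (intensityMeasure X P)) (s : Finset ℕ) :
    ‖∫ ω, ∏ i ∈ s, u (X i ω) ∂P - ∫ ω, ∏ i ∈ s, v (X i ω) ∂P‖ ≤
      ∫ y, ‖u y - v y‖ ∂intensityMeasure X P := by
  have hmap : ∀ i, Integrable (fun y => ‖u y - v y‖) (P.map (X i)) := fun i =>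
    huv.norm.mono_measure (Measure.le_sum _ i)
  have hcomp : ∀ i, Integrable (fun ω => ‖u (X i ω) - v (X i ω)‖) P := fun i =>
    (hmap i).comp_measurable (hX i)
  have hu_int := integrable_prod_of_norm_le_one (P := P) hX hu hu_le s
  have hv_int := integrable_prod_of_norm_le_one (P := P) hX hv hv_le s
  calc ‖∫ ω, ∏ i ∈ s, u (X i ω) ∂P - ∫ ω, ∏ i ∈ s, v (X i ω) ∂P‖
      ≤ ∫ ω, ‖∏ i ∈ s, u (X i ω) - ∏ i ∈ s, v (X i ω)‖ ∂P := by
        rw [← integral_sub hu_int hv_int]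
        exact norm_integral_le_integral_norm _
    _ ≤ ∫ ω, ∑ i ∈ s, ‖u (X i ω) - v (X i ω)‖ ∂P :=
        integral_mono (hu_int.sub hv_int).norm (integrable_finsetSum _ fun i _ => hcomp i)
          fun ω => norm_prod_sub_prod_le_sum (fun _ _ => hu_le _) fun _ _ => hv_le _
    _ = ∑ i ∈ s, ∫ y, ‖u y - v y‖ ∂P.map (X i) := by
        rw [integral_finsetSum _ fun i _ => hcomp i]
        exact Finset.sum_congr rfl fun i _ =>
          (integral_map (hX i).aemeasurable (hmap i).aestronglyMeasurable).symm
    _ ≤ ∫ y, ‖u y - v y‖ ∂intensityMeasure X P :=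
        sum_le_hasSum _ (fun _ _ => integral_nonneg fun _ => norm_nonneg _)
          (hasSum_integral_measure huv.norm)

end Bounded

end PointProcess

section GeneratingFunctional

variable {Ω E : Type*} [MeasurableSpace Ω] [MeasurableSpace E] {X : ℕ → Ω → E} {Λ : Measure E}
  {P : Measure Ω}

/-- The probability generating functional `u ↦ E ∏ᵢ u (X i)` of the point process `X 0, X 1, …` is
that of a Poisson point process, `E ∏ᵢ (1 - g (X i)) = exp (-∫ g)`, where the integral is with
respect to the intensity measure. The infinite product is encoded as the limit of the expected
partial products; complex-valued `g` are admitted so that characteristic functions of counts are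
covered. -/
def HasPoissonGeneratingFunctional (X : ℕ → Ω → E) (P : Measure Ω) : Prop :=
  ∀ g : E → ℂ, Measurable g → (∀ y, ‖1 - g y‖ ≤ 1) → Integrable g (intensityMeasure X P) →
    Tendsto (fun M => ∫ ω, ∏ i ∈ Finset.range M, (1 - g (X i ω)) ∂P) atTop
      (𝓝 (Complex.exp (-∫ y, g y ∂intensityMeasure X P)))

theorem lintegral_natCast_poissonMeasure (r : ℝ≥0) :
    ∫⁻ k, (k : ℝ≥0∞) ∂poissonMeasure r = r := by
  have lintegral_eq : ∀ f : ℕ → ℝ≥0∞, ∫⁻ k, f k ∂poissonMeasure r =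
      ∑' k : ℕ, ENNReal.ofReal (Real.exp (-r) * r ^ k / k.factorial) * f k := fun f => by
    simp [poissonMeasure, lintegral_sum_measure]
  have total_mass := lintegral_eq 1
  simp only [Pi.one_apply, lintegral_one, measure_univ, mul_one] at total_mass
  rw [lintegral_eq, tsum_eq_zero_add' ENNReal.summable, Nat.cast_zero, mul_zero, zero_add,
    ← mul_one (r : ℝ≥0∞), total_mass, ← ENNReal.tsum_mul_left]
  refine tsum_congr fun k => ?_
  rw [← ENNReal.ofReal_natCast, ← ENNReal.ofReal_mul (by positivity),
    ← ENNReal.ofReal_coe_nnreal, ← ENNReal.ofReal_mul (by positivity), Nat.factorial_succ]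
  congr 1
  push_cast
  field_simp
  ring

theorem integral_pow_poissonMeasure (r : ℝ≥0) (z : ℂ) :
    ∫ k, z ^ k ∂poissonMeasure r = Complex.exp (-((1 - z) * r)) := by
  rw [integral_poissonMeasure]
  calc ∑' k : ℕ, (Real.exp (-r) * r ^ k / k.factorial) • z ^ k
      = ∑' k : ℕ, Complex.exp (-r) * ((r * z) ^ k / k.factorial) := by
        refine tsum_congr fun k => ?_
        rw [Complex.real_smul, mul_pow]
        push_cast
        ring
    _ = Complex.exp (-r) * Complex.exp (r * z) := by
        rw [tsum_mul_left, Complex.exp_eq_exp_ℂ,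
          (NormedSpace.expSeries_div_hasSum_exp ((r : ℂ) * z)).tsum_eq]
    _ = Complex.exp (-((1 - z) * r)) := by
        rw [← Complex.exp_add]
        ring_nf

theorem one_sub_simpleFunc_eq_prod_mulIndicator (g : SimpleFunc E ℂ) (y : E) :
    1 - g y = ∏ c : {c ∈ g.range | c ≠ 0}, (g ⁻¹' {c.1}).mulIndicator (fun _ => 1 - c.1) y := by
  classical
  rw [Finset.prod_coe_sort {c ∈ g.range | c ≠ 0}
    fun c => (g ⁻¹' {c}).mulIndicator (fun _ => 1 - c) y, Finset.prod_filter_of_ne]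
  · rw [Finset.prod_eq_single (g y)]
    · simp
    · exact fun c _ hc => Set.mulIndicator_of_notMem (fun hy => hc hy.symm) _
    · exact fun hy => absurd (g.mem_range_self y) hy
  · rintro c - hc rfl
    simp at hc

namespace IsPoissonPointProcess

variable (hX : IsPoissonPointProcess X Λ P)
include hX

theorem intensityMeasure_apply {B : Set E} (hB : MeasurableSet B) (hfin : Λ B ≠ ⊤) :
    intensityMeasure X P B = Λ B := by
  rw [← lintegral_pointCount hX.measurable_point hB,
    (hX.count_law B hB hfin).lintegral_comp (f := fun k : ℕ∞ => (k : ℝ≥0∞))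
      Measurable.of_discrete.aemeasurable,
    lintegral_map .of_discrete .of_discrete]
  simp only [ENat.toENNReal_coe]
  rw [lintegral_natCast_poissonMeasure, ENNReal.coe_toNNReal hfin]

theorem intensityMeasure_eq [SigmaFinite Λ] : intensityMeasure X P = Λ := by
  refine Measure.ext_of_iUnion_eq_univ (iUnion_spanningSets Λ) fun k => ?_
  ext B hB
  rw [Measure.restrict_apply hB, Measure.restrict_apply hB]
  exact hX.intensityMeasure_apply (hB.inter (measurableSet_spanningSets Λ k))
    (measure_ne_top_of_subset Set.inter_subset_right (measure_spanningSets_lt_top Λ k).ne)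

theorem integral_pow_pointCount {B : Set E} (hB : MeasurableSet B) (hfin : Λ B ≠ ⊤) (z : ℂ) :
    ∫ ω, z ^ (pointCount X B ω).toNat ∂P = Complex.exp (-((1 - z) * Λ.real B)) := by
  refine ((hX.count_law B hB hfin).integral_comp (f := fun k : ℕ∞ => z ^ k.toNat)
    Measurable.of_discrete.aestronglyMeasurable).trans ?_
  rw [integral_map .of_discrete Measurable.of_discrete.aestronglyMeasurable]
  simp only [ENat.toNat_natCast]
  exact integral_pow_poissonMeasure _ z

theorem integral_prod_pow_pointCount {ι : Type*} [Fintype ι] {B : ι → Set E}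
    (hB : ∀ j, MeasurableSet (B j)) (hdisj : Pairwise fun j k => Disjoint (B j) (B k))
    (hfin : ∀ j, Λ (B j) ≠ ⊤) (z : ι → ℂ) :
    ∫ ω, ∏ j, z j ^ (pointCount X (B j) ω).toNat ∂P =
      Complex.exp (-∑ j, (1 - z j) * Λ.real (B j)) := by
  have hindep : iIndepFun (fun j => pointCount X (B j)) P := by
    let e := Fintype.equivFin ι
    simpa [e] using (hX.count_indep _ (fun k => B (e.symm k)) (fun k => hB _)
      fun k l hkl => hdisj (e.symm.injective.ne hkl)).precomp e.injective
  rw [hindep.integral_fun_prod_comp (f := fun j (k : ℕ∞) => z j ^ k.toNat)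
    (fun j => (measurable_pointCount hX.measurable_point (hB j)).aemeasurable)
    (fun j => Measurable.of_discrete.aestronglyMeasurable)]
  simp_rw [hX.integral_pow_pointCount (hB _) (hfin _)]
  rw [← Complex.exp_sum, Finset.sum_neg_distrib]

theorem tendsto_integral_prod_one_sub_simpleFunc [IsFiniteMeasure P] (g : SimpleFunc E ℂ)
    (hg : ∀ y, ‖1 - g y‖ ≤ 1) (hg_int : Integrable g Λ) :
    Tendsto (fun M => ∫ ω, ∏ i ∈ Finset.range M, (1 - g (X i ω)) ∂P) atTop
      (𝓝 (Complex.exp (-∫ y, g y ∂Λ))) := by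
  classical
  let B : {c ∈ g.range | c ≠ 0} → Set E := fun c => g ⁻¹' {c.1}
  have hB : ∀ c, MeasurableSet (B c) := fun c => g.measurableSet_fiber _
  have hdisj : Pairwise fun c d => Disjoint (B c) (B d) := fun c d hcd =>
    Disjoint.preimage g (Set.disjoint_singleton.2 (Subtype.coe_ne_coe.2 hcd))
  have hfin : ∀ c, Λ (B c) ≠ ⊤ := fun c =>
    (SimpleFunc.integrable_iff.1 hg_int c (Finset.mem_filter.1 c.2).2).ne
  have hcount : ∀ᵐ ω ∂P, ∀ c, pointCount X (B c) ω ≠ ⊤ := ae_all_iff.2 fun c =>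
    ae_pointCount_ne_top hX.measurable_point (hB c)
      ((hX.intensityMeasure_apply (hB c) (hfin c)).trans_ne (hfin c))
  have hintegral : ∫ y, g y ∂Λ = ∑ c, (1 - (1 - c.1)) * Λ.real (B c) := by
    rw [← SimpleFunc.integral_eq_integral g hg_int, SimpleFunc.integral_eq_sum_filter,
      ← Finset.sum_coe_sort {c ∈ g.range | c ≠ 0} fun c => Λ.real (g ⁻¹' {c}) • c]
    refine Finset.sum_congr rfl fun c _ => ?_
    rw [sub_sub_cancel, Complex.real_smul, mul_comm]
  rw [hintegral, ← hX.integral_prod_pow_pointCount hB hdisj hfin fun c => 1 - c.1]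
  refine tendsto_integral_prod_of_ae_tendsto (u := fun y => 1 - g y) hX.measurable_point
    (measurable_const.sub g.measurable) hg ?_
  filter_upwards [hcount] with ω hω
  simp only [one_sub_simpleFunc_eq_prod_mulIndicator g, Finset.prod_comm (s := Finset.range _)]
  exact tendsto_finsetProd _ fun c _ => tendsto_prod_mulIndicator_pow_pointCount (hω c) _

theorem hasPoissonGeneratingFunctional [SigmaFinite Λ] [IsFiniteMeasure P] :
    HasPoissonGeneratingFunctional X P := by
  intro g hg_meas hg hg_int
  obtain rfl := hX.intensityMeasure_eq
  let a : ℕ → SimpleFunc E ℂ :=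
    SimpleFunc.approxOn g hg_meas (Set.range g ∪ {0}) 0 (Set.mem_union_right _ rfl)
  have ha : ∀ k y, ‖1 - a k y‖ ≤ 1 := fun k y => by
    have hmem : a k y ∈ Set.range g ∪ {0} := SimpleFunc.approxOn_mem hg_meas _ k y
    rcases hmem with ⟨y', hy'⟩ | h0
    · exact hy' ▸ hg y'
    · exact h0 ▸ by simp
  have ha_int : ∀ k, Integrable (a k) (intensityMeasure X P) :=
    SimpleFunc.integrable_approxOn_range hg_meas hg_int
  have ha_lim : Tendsto (fun k => Complex.exp (-∫ y, a k y ∂intensityMeasure X P)) atTop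
      (𝓝 (Complex.exp (-∫ y, g y ∂intensityMeasure X P))) :=
    (Complex.continuous_exp.tendsto _).comp
      (tendsto_integral_of_L1 g hg_int.aestronglyMeasurable (.of_forall ha_int)
        (SimpleFunc.tendsto_approxOn_range_L1_enorm hg_meas hg_int)).neg
  refine TendstoUniformly.tendsto_of_eventually_tendsto (p := atTop)
    (F := fun k M => ∫ ω, ∏ i ∈ Finset.range M, (1 - a k (X i ω)) ∂P) ?_
    (.of_forall fun k => hX.tendsto_integral_prod_one_sub_simpleFunc (a k) (ha k) (ha_int k)) ha_lim
  rw [Metric.tendstoUniformly_iff]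
  intro ε hε
  filter_upwards [(tendsto_integral_norm_approxOn_sub hg_meas hg_int).eventually_lt_const hε]
    with k hk M
  refine lt_of_le_of_lt ?_ hk
  have hsub : ∀ y, 1 - g y - (1 - a k y) = a k y - g y := fun y => sub_sub_sub_cancel_left _ _ _
  have hcontract := norm_integral_prod_sub_integral_prod_le (u := fun y => 1 - g y)
    (v := fun y => 1 - a k y) hX.measurable_point (measurable_const.sub hg_meas) hg
    (measurable_const.sub (a k).measurable) (ha k)
    (by simpa only [hsub] using! (ha_int k).sub hg_int) (Finset.range M)
  simpa only [dist_eq_norm, hsub] using hcontract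

end IsPoissonPointProcess

end GeneratingFunctional

section Counts

variable {Ω E : Type*} [MeasurableSpace Ω] [MeasurableSpace E] {X : ℕ → Ω → E} {P : Measure Ω}
  [IsFiniteMeasure P]

theorem hasLaw_poissonMeasure_of_integral_pow {N : Ω → ℕ} (hN : AEMeasurable N P) (r : ℝ≥0)
    (hpgf : ∀ z : ℂ, ‖z‖ = 1 → ∫ ω, z ^ N ω ∂P = Complex.exp (-((1 - z) * r))) :
    HasLaw N (poissonMeasure r) P where
  aemeasurable := hN
  map_eq := by
    have := Measure.isFiniteMeasure_map P N
    refine (MeasurableEmbedding.natCast (α := ℝ)).map_injective (Measure.ext_of_charFun ?_)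
    funext t
    have hpow : ∀ k : ℕ, Complex.exp (t * (k : ℝ) * Complex.I) =
        Complex.exp (t * Complex.I) ^ k := fun k => by
      rw [← Complex.exp_nat_mul]
      push_cast
      ring_nf
    rw [charFun_map_cast_poissonMeasure, charFun_apply_real,
      integral_map (by fun_prop) (by fun_prop), integral_map hN .of_discrete]
    simp_rw [hpow]
    rw [hpgf _ (Complex.norm_exp_ofReal_mul_I t)]
    ring_nf

namespace HasPoissonGeneratingFunctional

variable (hX : HasPoissonGeneratingFunctional X P) (hX_meas : ∀ i, Measurable (X i)) {B : Set E}
  (hB : MeasurableSet B) (hfin : intensityMeasure X P B ≠ ⊤)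
include hX hX_meas hB hfin

theorem integral_pow_pointCount {z : ℂ} (hz : ‖z‖ ≤ 1) :
    ∫ ω, z ^ (pointCount X B ω).toNat ∂P =
      Complex.exp (-((1 - z) * (intensityMeasure X P).real B)) := by
  have hg : ∀ y, 1 - B.indicator (fun _ => 1 - z) y = B.mulIndicator (fun _ => z) y := fun y => by
    by_cases hy : y ∈ B <;> simp [hy]
  have hg_meas : Measurable (B.indicator fun _ => 1 - z) := measurable_const.indicator hB
  have hg_le : ∀ y, ‖1 - B.indicator (fun _ => 1 - z) y‖ ≤ 1 := fun y => by
    by_cases hy : y ∈ B <;> simp [hy, hz]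
  have hlim := hX _ hg_meas hg_le ((integrable_indicator_iff hB).2 (integrableOn_const hfin))
  rw [integral_indicator_const _ hB, Complex.real_smul, mul_comm] at hlim
  refine tendsto_nhds_unique (tendsto_integral_prod_of_ae_tendsto
    (u := fun y => 1 - B.indicator (fun _ => 1 - z) y) hX_meas (measurable_const.sub hg_meas)
    hg_le ?_) hlim
  filter_upwards [ae_pointCount_ne_top hX_meas hB hfin] with ω hω
  simpa only [hg] using tendsto_prod_mulIndicator_pow_pointCount hω z

theorem hasLaw_pointCount :
    HasLaw (pointCount X B)
      ((poissonMeasure (intensityMeasure X P B).toNNReal).map fun k : ℕ => (k : ℕ∞)) P := by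
  have hN : HasLaw (fun ω => (pointCount X B ω).toNat)
      (poissonMeasure (intensityMeasure X P B).toNNReal) P :=
    hasLaw_poissonMeasure_of_integral_pow
      (Measurable.of_discrete.comp (measurable_pointCount hX_meas hB)).aemeasurable _
      fun z hz => hX.integral_pow_pointCount hX_meas hB hfin hz.le
  have hcast : HasLaw (fun k : ℕ => (k : ℕ∞))
      ((poissonMeasure (intensityMeasure X P B).toNNReal).map fun k : ℕ => (k : ℕ∞))
      (poissonMeasure (intensityMeasure X P B).toNNReal) := ⟨.of_discrete, rfl⟩
  refine (hcast.comp hN).congr ?_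
  filter_upwards [ae_pointCount_ne_top hX_meas hB hfin] with ω hω
  exact (ENat.natCast_toNat hω).symm

end HasPoissonGeneratingFunctional

end Counts

section Marking

variable {Ω E : Type*} [MeasurableSpace Ω] [MeasurableSpace E] {X : ℕ → Ω → E} {h : ℕ → Ω → ℝ}
  {ν : Measure ℝ} {P : Measure Ω}

instance [SFinite P] : SFinite (intensityMeasure X P) :=
  inferInstanceAs (SFinite (Measure.sum fun i => P.map (X i)))

namespace IsIndependentMarking

variable (hh : IsIndependentMarking X h ν P)
include hh

theorem measurable_markedPoint (hX : ∀ i, Measurable (X i)) (i : ℕ) :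
    Measurable fun ω => (X i ω, h i ω) :=
  (hX i).prodMk (hh.measurable_mark i)

variable [IsProbabilityMeasure P]

theorem isProbabilityMeasure : IsProbabilityMeasure ν :=
  (hh.mark_law 0).isProbabilityMeasure_iff.1 inferInstance

variable (hX : ∀ i, Measurable (X i))
include hX

theorem intensityMeasure_markedPoint :
    intensityMeasure (fun i ω => (X i ω, h i ω)) P = (intensityMeasure X P).prod ν := by
  have := hh.isProbabilityMeasure
  have hmap : ∀ i, P.map (fun ω => (X i ω, h i ω)) = (P.map (X i)).prod ν := fun i => by
    have hindep : IndepFun (X i) (h i) P :=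
      hh.indep_points.comp (measurable_pi_apply i) (measurable_pi_apply i)
    rw [(indepFun_iff_map_prod_eq_prod_map_map (hX i).aemeasurable
      (hh.measurable_mark i).aemeasurable).1 hindep, (hh.mark_law i).map_eq]
  simp only [intensityMeasure, hmap, Measure.prod_sum_left]

theorem integral_prod_markedPoint {u : E × ℝ → ℂ} (hu : Measurable u) (hu_le : ∀ y, ‖u y‖ ≤ 1)
    (M : ℕ) :
    ∫ ω, ∏ i ∈ Finset.range M, u (X i ω, h i ω) ∂P =
      ∫ ω, ∏ i ∈ Finset.range M, ∫ k, u (X i ω, k) ∂ν ∂P := by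
  have := hh.isProbabilityMeasure
  have points_law : HasLaw (fun ω i => X i ω) (P.map fun ω i => X i ω) P :=
    ⟨(measurable_pi_lambda _ hX).aemeasurable, rfl⟩
  have := points_law.isProbabilityMeasure_iff.1 inferInstance
  have marks_law : HasLaw (fun ω (i : Fin M) => h i ω) (Measure.pi fun _ => ν) P :=
    (hh.mark_iIndep.precomp (g := fun i : Fin M => (i : ℕ)) Fin.val_injective).hasLaw_pi
      fun i => hh.mark_law i
  have joint_law : HasLaw (fun ω => ((fun i => X i ω), fun i : Fin M => h i ω))
      ((P.map fun ω i => X i ω).prod (Measure.pi fun _ => ν)) P :=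
    (indepFun_iff_hasLaw_prodMk_prod points_law marks_law).1 <|
      hh.indep_points.comp (ψ := fun (k : ℕ → ℝ) (i : Fin M) => k i) measurable_id (by fun_prop)
  let G : (ℕ → E) × (Fin M → ℝ) → ℂ := fun z => ∏ i : Fin M, u (z.1 i, z.2 i)
  have hG : StronglyMeasurable G :=
    (Finset.measurable_fun_prod _ fun i _ => hu.comp (by fun_prop)).stronglyMeasurable
  have hG_int : Integrable G ((P.map fun ω i => X i ω).prod (Measure.pi fun _ => ν)) :=
    Integrable.of_bound (C := 1) hG.aestronglyMeasurable
      (ae_of_all _ fun _ => norm_prod_le_one fun _ _ => hu_le _)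
  simp_rw [Finset.prod_range]
  calc ∫ ω, ∏ i : Fin M, u (X i ω, h i ω) ∂P
      = ∫ z, G z ∂(P.map fun ω i => X i ω).prod (Measure.pi fun _ => ν) :=
        joint_law.integral_comp (f := G) hG.aestronglyMeasurable
    _ = ∫ x, ∫ k, G (x, k) ∂Measure.pi (fun _ => ν) ∂P.map fun ω i => X i ω :=
        integral_prod _ hG_int
    _ = ∫ ω, ∫ k, G (fun i => X i ω, k) ∂Measure.pi (fun _ => ν) ∂P :=
        integral_map (measurable_pi_lambda _ hX).aemeasurable
          hG.integral_prod_right'.aestronglyMeasurable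
    _ = ∫ ω, ∏ i : Fin M, ∫ k, u (X i ω, k) ∂ν ∂P :=
        integral_congr_ae <| ae_of_all _ fun ω =>
          integral_fintype_prod_eq_prod fun (i : Fin M) k => u (X i ω, k)

theorem hasPoissonGeneratingFunctional (hP : HasPoissonGeneratingFunctional X P) :
    HasPoissonGeneratingFunctional (fun i ω => (X i ω, h i ω)) P := by
  have := hh.isProbabilityMeasure
  intro g hg_meas hg hg_int
  rw [hh.intensityMeasure_markedPoint hX] at hg_int ⊢
  have hg_norm : ∀ z, ‖g z‖ ≤ 2 := fun z => by
    calc ‖g z‖ = ‖1 - (1 - g z)‖ := by rw [sub_sub_cancel]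
      _ ≤ ‖(1 : ℂ)‖ + ‖1 - g z‖ := norm_sub_le _ _
      _ ≤ 2 := by linarith [norm_one (α := ℂ), hg z]
  have hsection : ∀ y, Integrable (fun k => g (y, k)) ν := fun y =>
    Integrable.of_bound (hg_meas.comp measurable_prodMk_left).aestronglyMeasurable 2
      (ae_of_all _ fun k => hg_norm (y, k))
  have hmean : ∀ y, ∫ k, (1 - g (y, k)) ∂ν = 1 - ∫ k, g (y, k) ∂ν := fun y => by
    rw [integral_sub (integrable_const 1) (hsection y), integral_const, probReal_univ, one_smul]
  have hlim := hP (fun y => ∫ k, g (y, k) ∂ν)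
    (hg_meas.stronglyMeasurable.integral_prod_right'.measurable)
    (fun y => by
      rw [← hmean]
      simpa using norm_integral_le_of_norm_le_const (μ := ν) (ae_of_all _ fun k => hg (y, k)))
    hg_int.integral_prod_left
  rw [integral_prod _ hg_int]
  refine hlim.congr fun M => ?_
  rw [hh.integral_prod_markedPoint hX (u := fun z => 1 - g z) (measurable_const.sub hg_meas) hg]
  simp_rw [hmean]

end IsIndependentMarking

end Marking

section Gamma

variable {a r : ℝ}

theorem measurable_gammaPDF (a r : ℝ) : Measurable (gammaPDF a r) :=
  (measurable_gammaPDFReal a r).ennreal_ofReal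

theorem ae_pos_gammaMeasure (a r : ℝ) : ∀ᵐ x ∂gammaMeasure a r, 0 < x := by
  rw [gammaMeasure, ae_withDensity_iff (measurable_gammaPDF a r)]
  filter_upwards [Measure.ae_ne volume 0] with x hx hpdf
  by_contra! hle
  exact hpdf (gammaPDF_of_neg (hle.lt_of_ne hx))

section Moments

variable {s : ℝ} (ha : 0 < a) (hr : 0 < r) (has : 0 < a + s)
include ha hr has

theorem lintegral_ofReal_rpow_gammaMeasure :
    ∫⁻ x, ENNReal.ofReal (x ^ s) ∂gammaMeasure a r =
      ENNReal.ofReal (Real.Gamma (a + s) / (r ^ s * Real.Gamma a)) := by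
  have := Real.Gamma_pos_of_pos ha
  have := Real.Gamma_pos_of_pos has
  -- Multiplication by `x ^ s` turns the density of `Γ(a, r)` into a multiple of that of
  -- `Γ(a + s, r)`.
  have tilt : ∀ᵐ x, gammaPDF a r x * ENNReal.ofReal (x ^ s) =
      ENNReal.ofReal (Real.Gamma (a + s) / (r ^ s * Real.Gamma a)) * gammaPDF (a + s) r x := by
    filter_upwards [Measure.ae_ne volume 0] with x hx
    rcases hx.lt_or_gt with hneg | hpos
    · rw [gammaPDF_of_neg hneg, gammaPDF_of_neg hneg, zero_mul, mul_zero]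
    · rw [gammaPDF_of_nonneg hpos.le, gammaPDF_of_nonneg hpos.le,
        ← ENNReal.ofReal_mul (by positivity), ← ENNReal.ofReal_mul (by positivity),
        add_sub_right_comm, Real.rpow_add hpos, Real.rpow_add hr]
      congr 1
      field_simp
  rw [gammaMeasure, lintegral_withDensity_eq_lintegral_mul _
    (measurable_gammaPDF a r) (by fun_prop)]
  simp only [Pi.mul_apply]
  rw [lintegral_congr_ae tilt,
    lintegral_const_mul _ (measurable_gammaPDF (a + s) r),
    lintegral_gammaPDF_eq_one has hr, mul_one]

theorem integrable_rpow_gammaMeasure : Integrable (fun x => x ^ s) (gammaMeasure a r) := by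
  refine (lintegral_ofReal_ne_top_iff_integrable (by fun_prop) ?_).1 ?_
  · filter_upwards [ae_pos_gammaMeasure a r] with x hx using Real.rpow_nonneg hx.le s
  · rw [lintegral_ofReal_rpow_gammaMeasure ha hr has]
    exact ENNReal.ofReal_ne_top

theorem integral_rpow_gammaMeasure :
    ∫ x, x ^ s ∂gammaMeasure a r = Real.Gamma (a + s) / (r ^ s * Real.Gamma a) := by
  have := Real.Gamma_pos_of_pos ha
  have := Real.Gamma_pos_of_pos has
  rw [integral_eq_lintegral_of_nonneg_ae _ (by fun_prop),
    lintegral_ofReal_rpow_gammaMeasure ha hr has, ENNReal.toReal_ofReal (by positivity)]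
  filter_upwards [ae_pos_gammaMeasure a r] with x hx using Real.rpow_nonneg hx.le s

end Moments

theorem poissonMeasure_real_Ici (r : ℝ≥0) (n : ℕ) : (poissonMeasure r).real (Set.Ici n) =
    1 - ∑ j ∈ Finset.range n, Real.exp (-r) * r ^ j / j.factorial := by
  rw [← Set.compl_Iio, probReal_compl_eq_one_sub measurableSet_Iio, ← Finset.coe_range,
    ← sum_measureReal_singleton]
  simp_rw [poissonMeasure_real_singleton]

theorem hasDerivAt_sum_range_exp_neg_mul_pow_div_factorial (k : ℕ) (r s : ℝ) :
    HasDerivAt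
      (fun s => ∑ j ∈ Finset.range (k + 1), Real.exp (-(r * s)) * (r * s) ^ j / j.factorial)
      (-(r ^ (k + 1) / k.factorial * s ^ k * Real.exp (-(r * s)))) s := by
  have hlin : HasDerivAt (fun s => r * s) r s := by simpa using (hasDerivAt_id s).const_mul r
  induction k with
  | zero => simpa [mul_comm] using hlin.neg.exp
  | succ k ih =>
    simp_rw [Finset.sum_range_succ _ (k + 1)]
    convert! ih.add
      ((hlin.neg.exp.mul (hlin.pow (k + 1))).div_const ((k + 1).factorial : ℝ)) using 1
    rw [Nat.factorial_succ]
    push_cast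
    field_simp
    simp only [Pi.neg_apply, Pi.pow_apply]
    ring

theorem gammaMeasure_Iic_eq_poissonMeasure_Ici {n : ℕ} (hn : n ≠ 0) {r t : ℝ≥0} (hr : 0 < r) :
    gammaMeasure n r (Set.Iic t) = poissonMeasure (r * t) (Set.Ici n) := by
  obtain ⟨k, rfl⟩ := Nat.exists_eq_add_one_of_ne_zero hn
  have := isProbabilityMeasure_gammaMeasure (a := (k + 1 : ℕ)) (r := r) (by positivity)
    (NNReal.coe_pos.2 hr)
  have hpdf : ∀ s : ℝ, 0 ≤ s → gammaPDFReal (k + 1 : ℕ) r s =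
      r ^ (k + 1) / k.factorial * s ^ k * Real.exp (-(r * s)) := fun s hs => by
    rw [gammaPDFReal, if_pos hs, Real.rpow_natCast, Nat.cast_succ, Real.Gamma_nat_eq_factorial,
      add_sub_cancel_right, Real.rpow_natCast]
  rw [← measureReal_eq_measureReal_iff, ← cdf_eq_real,
    cdf_gammaMeasure_eq_integral (by positivity) (NNReal.coe_pos.2 hr),
    poissonMeasure_real_Ici, NNReal.coe_mul]
  calc ∫ s in Set.Iic (t : ℝ), gammaPDFReal (k + 1 : ℕ) r s
      = ∫ s in Set.Icc 0 (t : ℝ), gammaPDFReal (k + 1 : ℕ) r s :=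
        (setIntegral_eq_of_subset_of_forall_sdiff_eq_zero measurableSet_Iic Set.Icc_subset_Iic_self
          fun s hs => if_neg fun h0 => hs.2 ⟨h0, hs.1⟩)
    _ = ∫ s in (0 : ℝ)..t, r ^ (k + 1) / k.factorial * s ^ k * Real.exp (-(r * s)) := by
        rw [intervalIntegral.integral_of_le t.coe_nonneg, ← integral_Icc_eq_integral_Ioc]
        exact setIntegral_congr_fun measurableSet_Icc fun s hs => hpdf s hs.1
    _ = 1 - ∑ j ∈ Finset.range (k + 1), Real.exp (-(r * t)) * (r * t) ^ j / j.factorial := by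
        rw [← neg_inj, ← intervalIntegral.integral_neg,
          intervalIntegral.integral_eq_sub_of_hasDerivAt
            (fun s _ => hasDerivAt_sum_range_exp_neg_mul_pow_div_factorial k r s)
            (Continuous.intervalIntegrable (by fun_prop) _ _)]
        simp [Finset.sum_range_succ']

end Gamma

theorem hasLaw_of_measure_setOf_le {Ω : Type*} [MeasurableSpace Ω] {P : Measure Ω}
    [IsProbabilityMeasure P] {μ : Measure ℝ} [IsProbabilityMeasure μ] {Y : Ω → ℝ}
    (hY : ∀ᵐ ω ∂P, 0 ≤ Y ω) (hμ : ∀ᵐ y ∂μ, 0 ≤ y)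
    (hY_meas : ∀ t > 0, NullMeasurableSet {ω | t ≤ Y ω} P)
    (htail : ∀ t > 0, P {ω | t ≤ Y ω} = μ (Set.Ici t)) : HasLaw Y μ P := by
  have hsure : ∀ t ≤ 0, ∀ᵐ ω ∂P, t ≤ Y ω := fun t ht => hY.mono fun ω => ht.trans
  have hY_null : NullMeasurable Y P := by
    refine measurable_of_Ici (δ := NullMeasurableSpace Ω P) fun t => ?_
    rcases lt_or_ge 0 t with ht | ht
    · exact hY_meas t ht
    · exact (MeasurableSet.univ.nullMeasurableSet).congr (eventuallyEq_univ.2 (hsure t ht)).symm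
  refine ⟨hY_null.aemeasurable, Measure.ext_of_Ici _ _ fun t => ?_⟩
  have := Measure.isProbabilityMeasure_map hY_null.aemeasurable
  rw [Measure.map_apply_of_aemeasurable hY_null.aemeasurable measurableSet_Ici]
  rcases lt_or_ge 0 t with ht | ht
  · exact htail t ht
  · have hP : Y ⁻¹' Set.Ici t =ᵐ[P] Set.univ := eventuallyEq_univ.2 (hsure t ht)
    have hμt : Set.Ici t =ᵐ[μ] Set.univ := eventuallyEq_univ.2 (hμ.mono fun _ => ht.trans)
    rw [measure_congr hP, measure_congr hμt, measure_univ, measure_univ]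

section NthLargest

variable {S : Set ℕ} {v : ℕ → ℝ} {n : ℕ}

theorem nthLargest_nonneg (hv : ∀ i, 0 ≤ v i) : 0 ≤ nthLargest S v n := by
  by_cases h0 : (n : ℕ∞) ≤ {i | i ∈ S ∧ 0 ≤ v i}.encard
  · by_cases hbdd : BddAbove {t : ℝ | (n : ℕ∞) ≤ {i | i ∈ S ∧ t ≤ v i}.encard}
    · exact le_csSup hbdd h0
    · rw [nthLargest, Real.sSup_of_not_bddAbove hbdd]
  · refine Real.sSup_nonneg fun t ht => le_of_not_gt fun _ => h0 ?_
    refine le_trans ht (Set.encard_le_encard fun i hi => ⟨hi.1, hv i⟩)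

theorem encard_setOf_le_antitone (S : Set ℕ) (v : ℕ → ℝ) :
    Antitone fun t : ℝ => {i | i ∈ S ∧ t ≤ v i}.encard :=
  fun _ _ hst => Set.encard_le_encard fun _ hi => ⟨hi.1, hst.trans hi.2⟩

theorem bddAbove_setOf_le_encard (hn : n ≠ 0) {s : ℝ} (hfin : {i | i ∈ S ∧ s ≤ v i}.Finite) :
    BddAbove {t : ℝ | (n : ℕ∞) ≤ {i | i ∈ S ∧ t ≤ v i}.encard} := by
  obtain ⟨b, hb⟩ := (hfin.image v).bddAbove
  refine ⟨max s b, fun t ht => le_of_not_gt fun hlt => ?_⟩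
  obtain ⟨hst, hbt⟩ := max_lt_iff.1 hlt
  have hempty : {i | i ∈ S ∧ t ≤ v i} = ∅ := Set.eq_empty_of_forall_notMem fun i hi =>
    (hb (Set.mem_image_of_mem v ⟨hi.1, hst.le.trans hi.2⟩)).not_gt (hbt.trans_le hi.2)
  rw [Set.mem_ofPred_eq, hempty, Set.encard_empty, nonpos_iff_eq_zero] at ht
  exact hn (by exact_mod_cast ht)

theorem le_nthLargest_iff (hn : n ≠ 0) {s t : ℝ} (hst : s < t) (ht : 0 < t)
    (hfin : {i | i ∈ S ∧ s ≤ v i}.Finite) :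
    t ≤ nthLargest S v n ↔ (n : ℕ∞) ≤ {i | i ∈ S ∧ t ≤ v i}.encard := by
  refine ⟨fun hle => ?_, fun hcard => le_csSup (bddAbove_setOf_le_encard hn hfin) hcard⟩
  have hne : {t : ℝ | (n : ℕ∞) ≤ {i | i ∈ S ∧ t ≤ v i}.encard}.Nonempty := by
    by_contra! hempty
    rw [nthLargest, hempty, Real.sSup_empty] at hle
    exact hle.not_gt ht
  have hgap : ∀ᶠ u in 𝓝[<] t, ∀ i ∈ {i | i ∈ S ∧ s ≤ v i}, u ≤ v i → t ≤ v i :=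
    (hfin.eventually_all).2 fun i _ => by
      rcases lt_or_ge (v i) t with hlt | hge
      · filter_upwards [Ioo_mem_nhdsLT hlt] with u hu hui using absurd hui hu.1.not_ge
      · exact .of_forall fun _ _ => hge
  obtain ⟨u, hu, hsu, hut⟩ := (hgap.and (Ioo_mem_nhdsLT hst)).exists
  obtain ⟨w, hw, huw⟩ := exists_lt_of_lt_csSup hne (hut.trans_le hle)
  calc (n : ℕ∞) ≤ {i | i ∈ S ∧ u ≤ v i}.encard :=
        le_trans hw (encard_setOf_le_antitone S v huw.le)
    _ ≤ {i | i ∈ S ∧ t ≤ v i}.encard :=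
        Set.encard_le_encard fun i hi => ⟨hi.1, hu i ⟨hi.1, hsu.le.trans hi.2⟩ hi.2⟩

end NthLargest

section Sector

theorem measurable_polarAngle : Measurable polarAngle := by
  have harg : Measurable fun v : Plane => (Complex.arg ⟨v 0, v 1⟩) :=
    Complex.measurable_arg.comp (Complex.measurableEquivRealProd.symm.measurable.comp
      (f := fun v : Plane => (v 0, v 1)) (by fun_prop))
  exact Measurable.ite (measurableSet_le measurable_const harg) harg (harg.add_const _)

theorem measurableSet_receptionSector (x : Plane) (φ : ℝ) :
    MeasurableSet (receptionSector x φ) :=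
  measurableSet_le (measurable_polarAngle.comp (measurable_id.sub_const x)) measurable_const

theorem lintegral_Ioc_ofReal_id {r : ℝ} (hr : 0 ≤ r) :
    ∫⁻ s in Set.Ioc 0 r, ENNReal.ofReal s = ENNReal.ofReal (r ^ 2 / 2) := by
  rw [← ofReal_integral_eq_lintegral_ofReal
    ((continuous_id'.integrableOn_Icc (a := (0 : ℝ)) (b := r)).mono_set Set.Ioc_subset_Icc_self),
    ← intervalIntegral.integral_of_le hr]
  · congr 1
    simp
  · filter_upwards [ae_restrict_mem measurableSet_Ioc] with s hs using hs.1.le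

theorem polarCoord_symm_mem_setOf_arg_mem_and_norm_le_iff {Θ : Set ℝ} {r s θ : ℝ} (hs : 0 < s)
    (hθ : θ ∈ Set.Ioo (-Real.pi) Real.pi) :
    Complex.polarCoord.symm (s, θ) ∈ {z : ℂ | Complex.arg z ∈ Θ ∧ ‖z‖ ≤ r} ↔ s ≤ r ∧ θ ∈ Θ := by
  have harg : Complex.arg (Complex.polarCoord.symm (s, θ)) = θ := by
    rw [Complex.polarCoord_symm_apply]
    simpa using Complex.arg_mul_cos_add_sin_mul_I hs (Set.Ioo_subset_Ioc_self hθ)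
  rw [Set.mem_ofPred_eq, harg, Complex.norm_polarCoord_symm, abs_of_pos hs, and_comm]

theorem volume_setOf_arg_mem_and_norm_le {Θ : Set ℝ} (hΘ : MeasurableSet Θ) {r : ℝ}
    (hr : 0 ≤ r) : volume {z : ℂ | Complex.arg z ∈ Θ ∧ ‖z‖ ≤ r} =
      ENNReal.ofReal (r ^ 2 / 2) * volume (Set.Ioo (-Real.pi) Real.pi ∩ Θ) := by
  have hS : MeasurableSet {z : ℂ | Complex.arg z ∈ Θ ∧ ‖z‖ ≤ r} :=
    (Complex.measurable_arg hΘ).inter (measurableSet_le measurable_norm measurable_const)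
  have hsplit : ∀ p ∈ polarCoord.target, ENNReal.ofReal p.1 •
      ({z : ℂ | Complex.arg z ∈ Θ ∧ ‖z‖ ≤ r}.indicator 1 (Complex.polarCoord.symm p) : ℝ≥0∞) =
        (Set.Iic r).indicator ENNReal.ofReal p.1 * Θ.indicator 1 p.2 := by
    classical
    rintro ⟨s, θ⟩ ⟨hs, hθ⟩
    have hmem := polarCoord_symm_mem_setOf_arg_mem_and_norm_le_iff (Θ := Θ) (r := r)
      (s := s) (θ := θ) hs hθ
    by_cases hsr : s ≤ r <;> by_cases hθΘ : θ ∈ Θ <;>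
      simp only [Set.indicator_apply, hmem, Set.mem_Iic, hsr, hθΘ] <;> simp
  calc volume {z : ℂ | Complex.arg z ∈ Θ ∧ ‖z‖ ≤ r}
      = ∫⁻ p in polarCoord.target, ENNReal.ofReal p.1 •
          {z : ℂ | Complex.arg z ∈ Θ ∧ ‖z‖ ≤ r}.indicator 1 (Complex.polarCoord.symm p) := by
        rw [Complex.lintegral_comp_polarCoord_symm, lintegral_indicator_one hS]
    _ = ∫⁻ p in Set.Ioi (0 : ℝ) ×ˢ Set.Ioo (-Real.pi) Real.pi,
          (Set.Iic r).indicator ENNReal.ofReal p.1 * Θ.indicator 1 p.2 := by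
        rw [setLIntegral_congr_fun polarCoord.open_target.measurableSet hsplit, polarCoord_target]
    _ = (∫⁻ s in Set.Ioi 0, (Set.Iic r).indicator ENNReal.ofReal s) *
          ∫⁻ θ in Set.Ioo (-Real.pi) Real.pi, Θ.indicator 1 θ := by
        rw [Measure.volume_eq_prod, ← Measure.prod_restrict, lintegral_prod_mul]
        · exact (ENNReal.measurable_ofReal.indicator measurableSet_Iic).aemeasurable
        · exact (measurable_one.indicator hΘ).aemeasurable
    _ = ENNReal.ofReal (r ^ 2 / 2) * volume (Set.Ioo (-Real.pi) Real.pi ∩ Θ) := by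
        rw [lintegral_indicator_one hΘ, setLIntegral_indicator measurableSet_Iic,
          Measure.restrict_apply hΘ, Set.inter_comm (Set.Iic r), Set.Ioi_inter_Iic,
          lintegral_Ioc_ofReal_id hr, Set.inter_comm]

variable {φ : ℝ} (hφ : 0 ≤ φ) (hφ' : φ ≤ 2 * Real.pi)
include hφ hφ'

theorem volume_Ioo_inter_setOf_ite_le :
    volume (Set.Ioo (-Real.pi) Real.pi ∩ {θ | (if 0 ≤ θ then θ else θ + 2 * Real.pi) ≤ φ}) =
      ENNReal.ofReal φ := by
  have hpi := Real.pi_pos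
  rcases lt_or_ge φ Real.pi with hlt | hge
  · have hset : Set.Ioo (-Real.pi) Real.pi ∩
        {θ | (if 0 ≤ θ then θ else θ + 2 * Real.pi) ≤ φ} = Set.Icc 0 φ := by
      ext θ
      simp only [Set.mem_inter_iff, Set.mem_Ioo, Set.mem_ofPred_eq, Set.mem_Icc]
      grind
    rw [hset, Real.volume_Icc, sub_zero]
  · have hset : Set.Ioo (-Real.pi) Real.pi ∩
        {θ | (if 0 ≤ θ then θ else θ + 2 * Real.pi) ≤ φ} =
          Set.Ioo (-Real.pi) Real.pi \ Set.Ioo (φ - 2 * Real.pi) 0 := by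
      ext θ
      simp only [Set.mem_inter_iff, Set.mem_Ioo, Set.mem_ofPred_eq, Set.mem_sdiff]
      grind
    rw [hset, measure_sdiff (Set.Ioo_subset_Ioo (by linarith) hpi.le)
      measurableSet_Ioo.nullMeasurableSet (by simp), Real.volume_Ioo, Real.volume_Ioo,
      ← ENNReal.ofReal_sub _ (by linarith)]
    congr 1
    ring

theorem volume_setOf_polarAngle_le_and_norm_le {r : ℝ} (hr : 0 ≤ r) :
    volume {v : Plane | polarAngle v ≤ φ ∧ ‖v‖ ≤ r} = ENNReal.ofReal (φ / 2 * r ^ 2) := by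
  have hS : MeasurableSet {v : Plane | polarAngle v ≤ φ ∧ ‖v‖ ≤ r} :=
    (measurableSet_le measurable_polarAngle measurable_const).inter
      (measurableSet_le measurable_norm measurable_const)
  have hΘ : MeasurableSet {θ : ℝ | (if 0 ≤ θ then θ else θ + 2 * Real.pi) ≤ φ} :=
    measurableSet_le (Measurable.ite (measurableSet_le measurable_const measurable_id)
      measurable_id (measurable_id.add_const _)) measurable_const
  have hpre : Complex.orthonormalBasisOneI.repr ⁻¹' {v : Plane | polarAngle v ≤ φ ∧ ‖v‖ ≤ r} =
      {z : ℂ | Complex.arg z ∈ {θ | (if 0 ≤ θ then θ else θ + 2 * Real.pi) ≤ φ} ∧ ‖z‖ ≤ r} := by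
    ext z
    simp [polarAngle]
  rw [← Complex.orthonormalBasisOneI.measurePreserving_repr.measure_preimage hS.nullMeasurableSet,
    hpre, volume_setOf_arg_mem_and_norm_le hΘ hr, volume_Ioo_inter_setOf_ite_le hφ hφ',
    ← ENNReal.ofReal_mul (by positivity)]
  congr 1
  ring

theorem volume_receptionSector_inter_closedBall (x : Plane) {r : ℝ} (hr : 0 ≤ r) :
    volume (receptionSector x φ ∩ Metric.closedBall x r) = ENNReal.ofReal (φ / 2 * r ^ 2) := by
  have hpre : receptionSector x φ ∩ Metric.closedBall x r =
      (· + -x) ⁻¹' {v : Plane | polarAngle v ≤ φ ∧ ‖v‖ ≤ r} := by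
    ext y
    simp only [receptionSector, Set.mem_inter_iff, mem_closedBall_iff_norm, Set.mem_ofPred_eq,
      Set.mem_preimage, sub_eq_add_neg]
  rw [hpre, measure_preimage_add_right,
    volume_setOf_polarAngle_le_and_norm_le hφ hφ' hr]

end Sector

section StrongInterferers

/-- The positions in the reception sector at `x` and the channel gains that cause an interference
power of at least `t` at `x`, as a set of marked points. -/
def strongInterferers (α : ℝ) (x : Plane) (φ t : ℝ) : Set (Plane × ℝ) :=
  {z | z.1 ∈ receptionSector x φ ∧ t ≤ z.2 * ‖x - z.1‖ ^ (-α)}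

theorem measurableSet_strongInterferers (α : ℝ) (x : Plane) (φ t : ℝ) :
    MeasurableSet (strongInterferers α x φ t) :=
  (measurable_fst (measurableSet_receptionSector x φ)).inter <|
    measurableSet_le (f := fun _ : Plane × ℝ => t) (g := fun z => z.2 * ‖x - z.1‖ ^ (-α))
      measurable_const (by fun_prop)

variable {α φ t : ℝ} (hα : 0 < α) (hφ : 0 ≤ φ) (hφ' : φ ≤ 2 * Real.pi) (ht : 0 < t) (x : Plane)
include hα hφ hφ' ht

theorem volume_strongInterferers_section {u : ℝ} (hu : 0 ≤ u) :
    volume ((fun y => (y, u)) ⁻¹' strongInterferers α x φ t) =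
      ENNReal.ofReal (φ / 2 * t ^ (-(2 / α)) * u ^ (2 / α)) := by
  have hball : ((fun y => (y, u)) ⁻¹' strongInterferers α x φ t) =ᵐ[volume]
      (receptionSector x φ ∩ Metric.closedBall x ((u / t) ^ α⁻¹) : Set Plane) := by
    filter_upwards [Measure.ae_ne volume x] with y hy
    have hd : 0 < ‖x - y‖ := norm_pos_iff.2 (sub_ne_zero.2 hy.symm)
    refine propext (and_congr_right fun _ => ?_)
    change t ≤ u * ‖x - y‖ ^ (-α) ↔ dist y x ≤ (u / t) ^ α⁻¹
    rw [dist_comm, dist_eq_norm, Real.le_rpow_inv_iff_of_pos hd.le (by positivity) hα,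
      Real.rpow_neg hd.le, ← div_eq_mul_inv, le_div_iff₀ (by positivity), le_div_iff₀ ht, mul_comm]
  have hsq : ((u / t) ^ α⁻¹) ^ 2 = t ^ (-(2 / α)) * u ^ (2 / α) := by
    rw [← Real.rpow_natCast, ← Real.rpow_mul (by positivity), Real.div_rpow hu ht.le,
      Real.rpow_neg ht.le, Nat.cast_ofNat, inv_mul_eq_div, div_eq_inv_mul]
  rw [measure_congr hball, volume_receptionSector_inter_closedBall hφ hφ' x (by positivity), hsq,
    mul_assoc]

theorem prod_strongInterferers {lam : ℝ} (hlam : 0 ≤ lam) {ν : Measure ℝ} [SFinite ν]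
    (hnonneg : ∀ᵐ u ∂ν, 0 ≤ u) (hmom : Integrable (fun u : ℝ => u ^ (2 / α)) ν) :
    ((ENNReal.ofReal lam • (volume : Measure Plane)).prod ν) (strongInterferers α x φ t) =
      ENNReal.ofReal (φ * (∫ u, u ^ (2 / α) ∂ν) * lam / 2 * t ^ (-(2 / α))) := by
  have hsection : ∀ᵐ u ∂ν, volume ((fun y => (y, u)) ⁻¹' strongInterferers α x φ t) =
      ENNReal.ofReal (φ / 2 * t ^ (-(2 / α)) * u ^ (2 / α)) := hnonneg.mono fun u =>
    volume_strongInterferers_section hα hφ hφ' ht x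
  rw [Measure.prod_smul_left, Measure.smul_apply,
    Measure.prod_apply_symm (measurableSet_strongInterferers α x φ t),
    lintegral_congr_ae hsection, ← ofReal_integral_eq_lintegral_ofReal (hmom.const_mul _),
    integral_const_mul, smul_eq_mul, ← ENNReal.ofReal_mul hlam]
  · congr 1
    ring
  · filter_upwards [hnonneg] with u hu
    positivity

end StrongInterferers

instance sigmaFinite_ofReal_smul {E : Type*} [MeasurableSpace E] (c : ℝ) (μ : Measure E)
    [SigmaFinite μ] : SigmaFinite (ENNReal.ofReal c • μ) :=
  inferInstanceAs (SigmaFinite (c.toNNReal • μ))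

section DominantInterference

variable {Ω : Type*} [MeasurableSpace Ω] {P : Measure Ω} [IsProbabilityMeasure P] {lam α φ t : ℝ}
  {X : ℕ → Ω → Plane} {h : ℕ → Ω → ℝ} {ν : Measure ℝ} (hlam : 0 ≤ lam) (hα : 0 < α) (hφ : 0 ≤ φ)
  (hφ' : φ ≤ 2 * Real.pi)
  (hX : IsPoissonPointProcess X (ENNReal.ofReal lam • (volume : Measure Plane)) P)
  (hh : IsIndependentMarking X h ν P) (hnonneg : ∀ᵐ u ∂ν, 0 ≤ u)
  (hmom : Integrable (fun u : ℝ => u ^ (2 / α)) ν) (x : Plane) {n : ℕ} (hn : n ≠ 0)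

omit [IsProbabilityMeasure P] in
include hh hnonneg in
theorem ae_interferencePower_nonneg :
    ∀ᵐ ω ∂P, ∀ i, 0 ≤ interferencePower X h α x i ω := by
  have hmark : ∀ i, ∀ᵐ ω ∂P, 0 ≤ h i ω := fun i =>
    ((hh.mark_law i).ae_iff (p := (0 ≤ ·)) (measurableSet_setOfPred.1 measurableSet_Ici)).2 hnonneg
  filter_upwards [ae_all_iff.2 hmark] with ω hω i
  exact mul_nonneg (hω i) (Real.rpow_nonneg (norm_nonneg _) _)

include hlam hα hφ hφ' hX hh hnonneg hmom

theorem intensityMeasure_strongInterferers (ht : 0 < t) :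
    intensityMeasure (fun i ω => (X i ω, h i ω)) P (strongInterferers α x φ t) =
      ENNReal.ofReal (φ * (∫ u, u ^ (2 / α) ∂ν) * lam / 2 * t ^ (-(2 / α))) := by
  have := hh.isProbabilityMeasure
  rw [hh.intensityMeasure_markedPoint hX.measurable_point, hX.intensityMeasure_eq,
    prod_strongInterferers hα hφ hφ' ht x hlam hnonneg hmom]

theorem hasLaw_pointCount_strongInterferers (ht : 0 < t) :
    HasLaw (pointCount (fun i ω => (X i ω, h i ω)) (strongInterferers α x φ t))
      ((poissonMeasure (φ * (∫ u, u ^ (2 / α) ∂ν) * lam / 2 * t ^ (-(2 / α))).toNNReal).map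
        fun k : ℕ => (k : ℕ∞)) P := by
  have hint := intensityMeasure_strongInterferers hlam hα hφ hφ' hX hh hnonneg hmom x ht
  have hlaw := (hh.hasPoissonGeneratingFunctional hX.measurable_point
    hX.hasPoissonGeneratingFunctional).hasLaw_pointCount
      (hh.measurable_markedPoint hX.measurable_point)
      (measurableSet_strongInterferers α x φ t) (hint ▸ ENNReal.ofReal_ne_top)
  rwa [hint] at hlaw

include hn

theorem ae_le_dominantInterference_iff (ht : 0 < t) :
    ∀ᵐ ω ∂P, t ≤ dominantInterference X h α x φ n ω ↔
      (n : ℕ∞) ≤ pointCount (fun i ω => (X i ω, h i ω)) (strongInterferers α x φ t) ω := by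
  have hint :=
    intensityMeasure_strongInterferers hlam hα hφ hφ' hX hh hnonneg hmom x (half_pos ht)
  filter_upwards [ae_pointCount_ne_top (hh.measurable_markedPoint hX.measurable_point)
    (measurableSet_strongInterferers α x φ (t / 2)) (hint ▸ ENNReal.ofReal_ne_top)] with ω hω
  exact le_nthLargest_iff hn (half_lt_self ht) ht (Set.encard_ne_top_iff.1 hω)

theorem measure_le_dominantInterference (ht : 0 < t) :
    P {ω | t ≤ dominantInterference X h α x φ n ω} =
      poissonMeasure (φ * (∫ u, u ^ (2 / α) ∂ν) * lam / 2 * t ^ (-(2 / α))).toNNReal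
        (Set.Ici n) := by
  have hlaw := hasLaw_pointCount_strongInterferers hlam hα hφ hφ' hX hh hnonneg hmom x ht
  have hcast : (fun k : ℕ => (k : ℕ∞)) ⁻¹' Set.Ici (n : ℕ∞) = Set.Ici n := by
    ext k
    simp
  calc P {ω | t ≤ dominantInterference X h α x φ n ω}
      = P {ω | (n : ℕ∞) ≤ pointCount (fun i ω => (X i ω, h i ω)) (strongInterferers α x φ t) ω} :=
        measure_congr <| by
          filter_upwards [ae_le_dominantInterference_iff hlam hα hφ hφ' hX hh hnonneg hmom x hn ht]
            with ω hω using propext hω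
    _ = (poissonMeasure _).map (fun k : ℕ => (k : ℕ∞)) (Set.Ici (n : ℕ∞)) :=
        hlaw.measure_eq .of_discrete
    _ = poissonMeasure _ (Set.Ici n) := by
        rw [Measure.map_apply .of_discrete .of_discrete, hcast]

theorem nullMeasurableSet_le_dominantInterference (ht : 0 < t) :
    NullMeasurableSet {ω | t ≤ dominantInterference X h α x φ n ω} P := by
  have hcount : MeasurableSet {ω | (n : ℕ∞) ≤
      pointCount (fun i ω => (X i ω, h i ω)) (strongInterferers α x φ t) ω} :=
    measurable_pointCount (hh.measurable_markedPoint hX.measurable_point)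
      (measurableSet_strongInterferers α x φ t) (.of_discrete (s := Set.Ici (n : ℕ∞)))
  refine hcount.nullMeasurableSet.congr ?_
  filter_upwards [ae_le_dominantInterference_iff hlam hα hφ hφ' hX hh hnonneg hmom x hn ht]
    with ω hω using propext hω.symm

end DominantInterference

theorem le_mul_rpow_neg_iff_le_div_rpow {c g t α : ℝ} (hc : 0 ≤ c) (hg : 0 < g) (ht : 0 < t)
    (hα : 0 < α) : g ≤ c * t ^ (-(2 / α)) ↔ t ≤ (c / g) ^ (α / 2) := by
  rw [← inv_div 2 α, Real.le_rpow_inv_iff_of_pos ht.le (by positivity) (by positivity),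
    le_div_iff₀' hg, Real.rpow_neg ht.le, ← div_eq_mul_inv, le_div_iff₀ (by positivity)]

theorem gammaMeasure_map_div_rpow_Ici {c t α : ℝ} (hc : 0 ≤ c) (ht : 0 < t) (hα : 0 < α) {n : ℕ}
    (hn : n ≠ 0) : (gammaMeasure n 1).map (fun g => (c / g) ^ (α / 2)) (Set.Ici t) =
      poissonMeasure (c * t ^ (-(2 / α))).toNNReal (Set.Ici n) := by
  have hm : 0 ≤ c * t ^ (-(2 / α)) := by positivity
  calc (gammaMeasure n 1).map (fun g => (c / g) ^ (α / 2)) (Set.Ici t)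
      = gammaMeasure n 1 ((fun g => (c / g) ^ (α / 2)) ⁻¹' Set.Ici t) :=
        Measure.map_apply (by fun_prop) measurableSet_Ici
    _ = gammaMeasure n 1 (Set.Iic (c * t ^ (-(2 / α)))) := measure_congr <| by
        filter_upwards [ae_pos_gammaMeasure n 1] with g hg
        exact propext (le_mul_rpow_neg_iff_le_div_rpow hc hg ht hα).symm
    _ = poissonMeasure (c * t ^ (-(2 / α))).toNNReal (Set.Ici n) := by
        simpa [hm] using gammaMeasure_Iic_eq_poissonMeasure_Ici hn (r := 1)
          (t := (c * t ^ (-(2 / α))).toNNReal) one_pos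

theorem hasLaw_dominantInterference {Ω : Type*} [MeasurableSpace Ω] {P : Measure Ω}
    [IsProbabilityMeasure P] {lam α φ : ℝ} (hlam : 0 ≤ lam) (hα : 0 < α) (hφ : 0 ≤ φ)
    (hφ' : φ ≤ 2 * Real.pi) {X : ℕ → Ω → Plane} {h : ℕ → Ω → ℝ} {ν : Measure ℝ}
    (hX : IsPoissonPointProcess X (ENNReal.ofReal lam • (volume : Measure Plane)) P)
    (hh : IsIndependentMarking X h ν P) (hnonneg : ∀ᵐ u ∂ν, 0 ≤ u)
    (hmom : Integrable (fun u : ℝ => u ^ (2 / α)) ν) (x : Plane) {n : ℕ} (hn : n ≠ 0) :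
    HasLaw (dominantInterference X h α x φ n) ((gammaMeasure n 1).map fun g =>
      (φ * (∫ u, u ^ (2 / α) ∂ν) * lam / 2 / g) ^ (α / 2)) P := by
  have hM : 0 ≤ ∫ u, u ^ (2 / α) ∂ν :=
    integral_nonneg_of_ae (hnonneg.mono fun u hu => Real.rpow_nonneg hu _)
  have := isProbabilityMeasure_gammaMeasure (a := n) (r := 1) (by positivity) one_pos
  have hmeas : Measurable fun g : ℝ => (φ * (∫ u, u ^ (2 / α) ∂ν) * lam / 2 / g) ^ (α / 2) := by
    fun_prop
  have := Measure.isProbabilityMeasure_map (μ := gammaMeasure n 1) hmeas.aemeasurable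
  refine hasLaw_of_measure_setOf_le ?_ ?_ (fun t ht => ?_) fun t ht => ?_
  · filter_upwards [ae_interferencePower_nonneg hh hnonneg x] with ω hω using nthLargest_nonneg hω
  · refine (ae_map_iff hmeas.aemeasurable measurableSet_Ici).2 ?_
    filter_upwards [ae_pos_gammaMeasure n 1] with g hg
    positivity
  · exact nullMeasurableSet_le_dominantInterference hlam hα hφ hφ' hX hh hnonneg hmom x hn ht
  · rw [measure_le_dominantInterference hlam hα hφ hφ' hX hh hnonneg hmom x hn ht,
      gammaMeasure_map_div_rpow_Ici (by positivity) ht hα hn]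

theorem mainTheorem3_general {Ω : Type*} [MeasurableSpace Ω] (P : Measure Ω)
    [IsProbabilityMeasure P] (lam α φ : ℝ) (hlam : 0 < lam) (hα : 0 < α) (hφ : 0 < φ)
    (hφ' : φ ≤ 2 * Real.pi) (X : ℕ → Ω → Plane) (h : ℕ → Ω → ℝ) (ν : Measure ℝ)
    (hX : IsPoissonPointProcess X (ENNReal.ofReal lam • (volume : Measure Plane)) P)
    (hh : IsIndependentMarking X h ν P)
    (hnonneg : ∀ᵐ u ∂ν, 0 ≤ u)
    (hmom : Integrable (fun u : ℝ => u ^ (2 / α)) ν)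
    (x : Plane) (n : ℕ) (hn : α / 2 < n) :
    Integrable (dominantInterference X h α x φ n) P ∧
      ∫ ω, dominantInterference X h α x φ n ω ∂P =
        (φ * (∫ u, u ^ (2 / α) ∂ν) * lam / 2) ^ (α / 2) *
          (Real.Gamma (n - α / 2) / Real.Gamma n) := by
  have hn0 : (0 : ℝ) < n := (half_pos hα).trans hn
  have hgap : 0 < (n : ℝ) + -(α / 2) := by linarith
  have hM : 0 ≤ ∫ u, u ^ (2 / α) ∂ν :=
    integral_nonneg_of_ae (hnonneg.mono fun u hu => Real.rpow_nonneg hu _)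
  have hlaw := hasLaw_dominantInterference hlam.le hα hφ.le hφ' hX hh hnonneg hmom x
    (Nat.cast_pos.1 hn0).ne'
  set c := φ * (∫ u, u ^ (2 / α) ∂ν) * lam / 2
  have hmeas : Measurable fun g : ℝ => (c / g) ^ (α / 2) := by fun_prop
  have hsplit : (fun g : ℝ => (c / g) ^ (α / 2)) =ᵐ[gammaMeasure n 1]
      fun g => c ^ (α / 2) * g ^ (-(α / 2)) := by
    filter_upwards [ae_pos_gammaMeasure n 1] with g hg
    rw [Real.div_rpow (by positivity) hg.le, Real.rpow_neg hg.le, div_eq_mul_inv]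
  constructor
  · have hint : Integrable id ((gammaMeasure n 1).map fun g : ℝ => (c / g) ^ (α / 2)) :=
      (integrable_map_measure (by fun_prop) hmeas.aemeasurable).2 <|
        ((integrable_rpow_gammaMeasure hn0 one_pos hgap).const_mul _).congr hsplit.symm
    exact (hlaw.map_eq ▸ hint).comp_aemeasurable hlaw.aemeasurable
  · rw [hlaw.integral_eq, integral_map hmeas.aemeasurable (by fun_prop),
      integral_congr_ae hsplit, integral_const_mul, integral_rpow_gammaMeasure hn0 one_pos hgap,
      Real.one_rpow, one_mul, ← sub_eq_add_neg]

theorem mainTheorem3 {Ω : Type*} [MeasurableSpace Ω] (P : Measure Ω) [IsProbabilityMeasure P]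
    (lam α φ : ℝ) (hlam : 0 < lam) (hα : 2 < α) (hφ : 0 < φ) (hφ' : φ ≤ 2 * Real.pi)
    (X : ℕ → Ω → Plane) (h : ℕ → Ω → ℝ) (ν : Measure ℝ)
    (hX : IsPoissonPointProcess X (ENNReal.ofReal lam • (volume : Measure Plane)) P)
    (hh : IsIndependentMarking X h ν P)
    (hpos : ∀ᵐ u ∂ν, 0 < u)
    (hmom : Integrable (fun u : ℝ => u ^ (2 / α)) ν)
    (x : Plane) (n : ℕ) (hn : α / 2 < n) :
    Integrable (dominantInterference X h α x φ n) P ∧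
      ∫ ω, dominantInterference X h α x φ n ω ∂P =
        (φ * (∫ u, u ^ (2 / α) ∂ν) * lam / 2) ^ (α / 2) *
          (Real.Gamma (n - α / 2) / Real.Gamma n) := by
  exact mainTheorem3_general P lam α φ hlam (by linarith) hφ hφ' X h ν hX hh
    (hpos.mono fun _ => le_of_lt) hmom x n hn
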